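/- Conventions. An extriangulated category $(\mathcal{C},\mathbb{E},\mathfrak{s})$ is one in the sense of Nakaoka–Palu. Sets (index sets, Hom sets, groups of extensions) are taken in one common universe. For $\delta\in\mathbb{E}(X,A)$, $a:A\to A'$, $c:X'\to X$ write $a\cdot\delta=\mathbb{E}(X,a)(\delta)$, $\delta\cdot c=\mathbb{E}(c,A)(\delta)$. A conflation is a sequence $A\to B\to X$ realizing some $\delta\in\mathbb{E}(X,A)$. For a functor $F$, $\operatorname{Im}F$ is its essential image and $\operatorname{Ker}F$ the class of objects sent to zero. For classes of objects $\mathcal{X},\mathcal{Y}$, $\mathcal{X}\star\mathcal{Y}$ is the class of all $B$ admitting a conflation $X\to B\to Y$ with $X\in\mathcal{X}$, $Y\in\mathcal{Y}$. Functors. An additive functor $F$ is extriangulated if it comes with a natural transformation $\Gamma_F:\mathbb{E}_{\mathcal{C}}\to\mathbb{E}_{\mathcal{D}}(F-,F-)$ of $\mathrm{Ab}$-valued bifunctors such that $\Gamma_F(\delta)$ is realized by $FA\to FB\to FX$ whenever $\delta$ is realized by $A\to B\to X$. It is right exact if for every conflation $C_1\xrightarrow{a}C\xrightarrow{b}C_2$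 there are conflations $B_1\to FC_1\xrightarrow{x}B_2$ and $B_2\xrightarrow{y}FC\xrightarrow{Fb}FC_2$ with $y x=Fa$; left exactness is dual. Recollements. A recollement $(\mathcal{A},\mathcal{B},\mathcal{C})$ of extriangulated categories consists of additive functors $i^*,i^!:\mathcal{B}\to\mathcal{A}$, $i_*:\mathcal{A}\to\mathcal{B}$, $j_!,j_*:\mathcal{C}\to\mathcal{B}$, $j^*:\mathcal{B}\to\mathcal{C}$ such that $(i^*,i_*,i^!)$ and $(j_!,j^*,j_*)$ are adjoint triples; $i_*,j_!,j_*$ are fully faithful; $\operatorname{Im}i_*=\operatorname{Ker}j^*$; $i^*,j_!$ are right exact; $i^!,j_*$ are left exact; $i_*,j^*$ are extriangulated; and $(\operatorname{Ker}i^*,\operatorname{Im}i_*,\operatorname{Ker}i^!)$ is a TTF triple, i.e. $\operatorname{Hom}(\operatorname{Im}i_*,\operatorname{Ker}i^!)=0=\operatorname{Hom}(\operatorname{Ker}i^*,\operatorname{Im}i_*)$ and $\mathcal{B}=\operatorname{Ker}i^*\star\operatorname{Im}i_*=\operatorname{Im}i_*\star\operatorname{Ker}i^!$. AET4. $\mathcal{C}$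 is AET3 if all coproducts indexed by nonempty sets exist. It is AET4 if it is AET3 and for every set $I\ne\emptyset$ there are homomorphisms $\Gamma:\prod_{i\in I}\mathbb{E}(B_i,A)\to\mathbb{E}(\coprod_{i\in I}B_i,A^{(I)})$, natural in $(B_i)_{i\in I}$ and in $A$, such that (1) if $\eta_i$ is realized by $A\xrightarrow{f_i}E_i\xrightarrow{g_i}B_i$ for all $i$, then $\Gamma((\eta_i)_i)$ is realized by $A^{(I)}\xrightarrow{\coprod f_i}\coprod E_i\xrightarrow{\coprod g_i}\coprod B_i$; and (2) for the canonical inclusions $\mu_i^B:B_i\to\coprod_jB_j$ and $\mu_i^A:A\to A^{(I)}$, one has $\Gamma((\eta_j)_j)\cdot\mu_i^B=\mu_i^A\cdot\eta_i$ for all $i\in I$. $\mathcal{C}$ is AET3* (AET4*) if $\mathcal{C}^{op}$ is AET3 (AET4). Compatibility. A negative first extension on $\mathcal{C}$ is an additive bifunctor $\mathbb{E}^{-1}:\mathcal{C}^{op}\times\mathcal{C}\to\mathrm{Ab}$ together with, for each $\delta\in\mathbb{E}(X,A)$, natural transformations $\mathbb{E}^{-1}(-,X)\to\operatorname{Hom}(-,A)$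 and $\mathbb{E}^{-1}(A,-)\to\operatorname{Hom}(X,-)$ such that, for every realization $A\to B\to X$ of $\delta$ and every $W$, the sequences $$\mathbb{E}^{-1}(W,A)\to\mathbb{E}^{-1}(W,B)\to\mathbb{E}^{-1}(W,X)\to\operatorname{Hom}(W,A)\to\operatorname{Hom}(W,B),$$ $$\mathbb{E}^{-1}(X,W)\to\mathbb{E}^{-1}(B,W)\to\mathbb{E}^{-1}(A,W)\to\operatorname{Hom}(X,W)\to\operatorname{Hom}(B,W)$$ are exact. $\mathcal{C}$ with such an $\mathbb{E}^{-1}$ is coproduct-compatible if it is AET3 and for all $X$ and all nonempty families $(Y_i)_{i\in I}$ the canonical map $\mathbb{E}^{-1}(\coprod Y_i,X)\to\prod\mathbb{E}^{-1}(Y_i,X)$ is surjective; it is product-compatible if it is AET3* and the canonical maps $\mathbb{E}^{-1}(X,\prod Y_i)\to\prod\mathbb{E}^{-1}(X,Y_i)$ are surjective. Theorem. Let $(\mathcal{A},\mathcal{B},\mathcal{C})$ be a recollement of extriangulated categories. (a) If $\mathcal{A}$ is coproduct-compatible and $\mathcal{B}$ is AET4, then $\mathcal{A}$ is AET4. (b)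 If $\mathcal{A}$ is product-compatible and $\mathcal{B}$ is AET4*, then $\mathcal{A}$ is AET4*. (c) If $\mathcal{B}$ is AET4 or AET4*, then $\Gamma_{i_*}:\mathbb{E}_{\mathcal{A}}\to\mathbb{E}_{\mathcal{B}}(i_*-,i_*-)$ is an isomorphism. -/

import Mathlib

open CategoryTheory CategoryTheory.Limits Opposite

universe v u u₁ u₂ u₃

namespace Extriang

/-! ### Extriangulated categories -/

section Basic

/-- The data underlying an extriangulated category: a bifunctor `𝔼 : Cᵒᵖ × C ⥤ Ab` and a
correspondence `𝔰`, written as a relation: `Realizes δ x y` says that the sequence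
`A --x--> B --y--> X` belongs to the class `𝔰(δ)`, for `δ ∈ 𝔼(X, A)`. -/
class ExtensionStructure (C : Type u) [Category.{v} C] [Preadditive C] where
  /-- The bifunctor `𝔼`, contravariant in the first variable. -/
  bifunctor : Cᵒᵖ ⥤ C ⥤ AddCommGrpCat.{v}
  /-- `Realizes δ x y`: the sequence `(x, y)` is a realization of `δ`. -/
  Realizes : ∀ {A B X : C}, ((bifunctor.obj (op X)).obj A) → (A ⟶ B) → (B ⟶ X) → Prop

variable {C : Type u} [Category.{v} C] [Preadditive C] [ExtensionStructure C]

/-- The abelian group `𝔼(X, A)` of extensions of `X` by `A`. -/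
abbrev EE (X A : C) : Type v :=
  ((ExtensionStructure.bifunctor (C := C)).obj (op X)).obj A

/-- `a · δ`, that is `𝔼(X, a)(δ)`. -/
def push {X A A' : C} (a : A ⟶ A') : EE X A →+ EE X A' :=
  (((ExtensionStructure.bifunctor (C := C)).obj (op X)).map a).hom

/-- `δ · c`, that is `𝔼(c, A)(δ)`. -/
def pull {X X' A : C} (c : X' ⟶ X) : EE X A →+ EE X' A :=
  (((ExtensionStructure.bifunctor (C := C)).map c.op).app A).hom

/-- `Realizes δ x y`: the sequence `A --x--> B --y--> X` realizes `δ ∈ 𝔼(X, A)`. -/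
def Realizes {A B X : C} (δ : EE X A) (x : A ⟶ B) (y : B ⟶ X) : Prop :=
  ExtensionStructure.Realizes δ x y

/-- The sequence `A --x--> B --y--> X` is a conflation: it realizes some extension. -/
def IsConflation {A B X : C} (x : A ⟶ B) (y : B ⟶ X) : Prop :=
  ∃ δ : EE X A, Realizes δ x y

/-- Two sequences `A ⟶ B ⟶ X` and `A ⟶ B' ⟶ X` are equivalent if there is an isomorphism
`B ≅ B'` compatible with the morphisms. -/
def SeqEquiv {A B B' X : C} (x : A ⟶ B) (y : B ⟶ X) (x' : A ⟶ B') (y' : B' ⟶ X) : Prop :=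
  ∃ e : B ≅ B', x ≫ e.hom = x' ∧ e.hom ≫ y' = y

/-- `δ ⊕ δ' ∈ 𝔼(X ⊕ X', A ⊕ A')`, the extension with matrix `diag(δ, δ')`. -/
noncomputable def directSum [HasBinaryBiproducts C] {X X' A A' : C} (δ : EE X A)
    (δ' : EE X' A') : EE (X ⊞ X') (A ⊞ A') :=
  push biprod.inl (pull biprod.fst δ) + push biprod.inr (pull biprod.snd δ')

end Basic

/-- Extriangulated categories (Nakaoka--Palu). -/
class ExtriangulatedCategory (C : Type u) [Category.{v} C] [Preadditive C] [HasZeroObject C]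
    [HasBinaryBiproducts C] extends ExtensionStructure C where
  /-- (ET1) `𝔼` is additive in the contravariant variable. -/
  additive_left : bifunctor.Additive
  /-- (ET1) `𝔼` is additive in the covariant variable. -/
  additive_right : ∀ X : Cᵒᵖ, (bifunctor.obj X).Additive
  /-- Each `𝔰(δ)` is nonempty. -/
  exists_realization : ∀ {X A : C} (δ : EE X A),
    ∃ (B : C) (x : A ⟶ B) (y : B ⟶ X), Extriang.Realizes δ x y
  /-- Each `𝔰(δ)` is exactly one equivalence class of sequences. -/
  realizes_iff : ∀ {X A B B' : C} (δ : EE X A) (x : A ⟶ B) (y : B ⟶ X) (x' : A ⟶ B')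
    (y' : B' ⟶ X), Extriang.Realizes δ x y →
      (Extriang.Realizes δ x' y' ↔ SeqEquiv x y x' y')
  /-- (ET2) `𝔰` is a realization: every morphism of extensions `(a, c) : δ ⟶ δ'` lifts to a
  morphism of sequences. -/
  realize_hom : ∀ {X A B X' A' B' : C} (δ : EE X A) (δ' : EE X' A')
    (x : A ⟶ B) (y : B ⟶ X) (x' : A' ⟶ B') (y' : B' ⟶ X'),
    Extriang.Realizes δ x y → Extriang.Realizes δ' x' y' →
    ∀ (a : A ⟶ A') (c : X ⟶ X'), push a δ = pull c δ' →
      ∃ b : B ⟶ B', x ≫ b = a ≫ x' ∧ y ≫ c = b ≫ y'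
  /-- (ET2) The zero extension is realized by the split sequence. -/
  realizes_zero : ∀ X A : C,
    Extriang.Realizes (0 : EE X A) (biprod.inl : A ⟶ A ⊞ X) (biprod.snd : A ⊞ X ⟶ X)
  /-- (ET2) `𝔰(δ ⊕ δ') = 𝔰(δ) ⊕ 𝔰(δ')`. -/
  realizes_directSum : ∀ {X A B X' A' B' : C} (δ : EE X A) (δ' : EE X' A')
    (x : A ⟶ B) (y : B ⟶ X) (x' : A' ⟶ B') (y' : B' ⟶ X'),
    Extriang.Realizes δ x y → Extriang.Realizes δ' x' y' →
      Extriang.Realizes (directSum δ δ') (biprod.map x x') (biprod.map y y')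
  /-- (ET3) -/
  et3 : ∀ {X A B X' A' B' : C} (δ : EE X A) (δ' : EE X' A')
    (x : A ⟶ B) (y : B ⟶ X) (x' : A' ⟶ B') (y' : B' ⟶ X'),
    Extriang.Realizes δ x y → Extriang.Realizes δ' x' y' →
    ∀ (a : A ⟶ A') (b : B ⟶ B'), x ≫ b = a ≫ x' →
      ∃ c : X ⟶ X', push a δ = pull c δ' ∧ y ≫ c = b ≫ y'
  /-- (ET3)ᵒᵖ -/
  et3_op : ∀ {X A B X' A' B' : C} (δ : EE X A) (δ' : EE X' A')
    (x : A ⟶ B) (y : B ⟶ X) (x' : A' ⟶ B') (y' : B' ⟶ X'),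
    Extriang.Realizes δ x y → Extriang.Realizes δ' x' y' →
    ∀ (b : B ⟶ B') (c : X ⟶ X'), y ≫ c = b ≫ y' →
      ∃ a : A ⟶ A', push a δ = pull c δ' ∧ x ≫ b = a ≫ x'
  /-- (ET4) -/
  et4 : ∀ {A B D Y F : C} (δ : EE D A) (δ' : EE F B)
    (f : A ⟶ B) (f' : B ⟶ D) (g : B ⟶ Y) (g' : Y ⟶ F),
    Extriang.Realizes δ f f' → Extriang.Realizes δ' g g' →
      ∃ (E : C) (d : D ⟶ E) (e : E ⟶ F) (h' : Y ⟶ E) (δ'' : EE E A),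
        f' ≫ d = g ≫ h' ∧ h' ≫ e = g' ∧
        Extriang.Realizes δ'' (f ≫ g) h' ∧
        Extriang.Realizes (push f' δ') d e ∧
        pull d δ'' = δ ∧ push f δ'' = pull e δ'
  /-- (ET4)ᵒᵖ -/
  et4_op : ∀ {A B D Y F : C} (δ : EE B D) (δ' : EE Y F)
    (f' : D ⟶ A) (f : A ⟶ B) (g' : F ⟶ B) (g : B ⟶ Y),
    Extriang.Realizes δ f' f → Extriang.Realizes δ' g' g →
      ∃ (E : C) (d : D ⟶ E) (e : E ⟶ F) (h' : E ⟶ A) (δ'' : EE Y E),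
        d ≫ h' = f' ∧ e ≫ g' = h' ≫ f ∧
        Extriang.Realizes δ'' h' (f ≫ g) ∧
        Extriang.Realizes (pull g' δ) d e ∧
        push e δ'' = δ' ∧ push d δ = pull g δ''

/-! ### The conditions AET3, AET4 and their duals -/

section AET

variable (C : Type u) [Category.{v} C] [Preadditive C] [HasZeroObject C]
  [HasBinaryBiproducts C] [ExtriangulatedCategory C]

/-- AET3: all coproducts indexed by nonempty sets exist. -/
def IsAET3 : Prop :=
  ∀ (I : Type v) [Nonempty I], HasCoproductsOfShape I C

/-- AET3*: all products indexed by nonempty sets exist. -/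
def IsAET3Star : Prop :=
  ∀ (I : Type v) [Nonempty I], HasProductsOfShape I C

/-- For a given `I`, a transformation `Γ : ∏ᵢ 𝔼(Bᵢ, A) ⟶ 𝔼(∐ᵢ Bᵢ, A^(I))`, natural in the family
`B` and in `A`, such that coproducts and coproduct inclusions are extriangulated. -/
structure CoproductTransformation (I : Type v) [HasCoproductsOfShape I C] where
  /-- The components of `Γ`. -/
  Γ : ∀ (B : I → C) (A : C), (∀ i, EE (B i) A) →+ EE (∐ B) (∐ fun _ : I => A)
  /-- `Γ` is natural in the family `B`. -/
  natural_left : ∀ {B B' : I → C} (c : ∀ i, B' i ⟶ B i) (A : C) (η : ∀ i, EE (B i) A),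
    Γ B' A (fun i => pull (c i) (η i)) = pull (Limits.Sigma.map c) (Γ B A η)
  /-- `Γ` is natural in `A`. -/
  natural_right : ∀ (B : I → C) {A A' : C} (a : A ⟶ A') (η : ∀ i, EE (B i) A),
    Γ B A' (fun i => push a (η i)) = push (Limits.Sigma.map fun _ : I => a) (Γ B A η)
  /-- Coproducts are extriangulated. -/
  realizes : ∀ (B : I → C) (A : C) (η : ∀ i, EE (B i) A) (E : I → C)
    (f : ∀ i, A ⟶ E i) (g : ∀ i, E i ⟶ B i), (∀ i, Realizes (η i) (f i) (g i)) →
      Realizes (Γ B A η) (Limits.Sigma.map f) (Limits.Sigma.map g)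
  /-- Coproduct inclusions are extriangulated. -/
  inclusions : ∀ (B : I → C) (A : C) (η : ∀ i, EE (B i) A) (i : I),
    pull (Sigma.ι B i) (Γ B A η) = push (Sigma.ι (fun _ : I => A) i) (η i)

/-- AET4. -/
def IsAET4 : Prop :=
  ∀ (I : Type v) [Nonempty I],
    ∃ _ : HasCoproductsOfShape I C, Nonempty (CoproductTransformation C I)

/-- For a given `I`, a transformation `Γ : ∏ᵢ 𝔼(A, Bᵢ) ⟶ 𝔼(A^I, ∏ᵢ Bᵢ)`, natural in `A` and in the
family `B`, such that products and product projections are extriangulated. This is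
`CoproductTransformation` for the opposite category, written out in `C`. -/
structure ProductTransformation (I : Type v) [HasProductsOfShape I C] where
  /-- The components of `Γ`. -/
  Γ : ∀ (A : C) (B : I → C), (∀ i, EE A (B i)) →+ EE (∏ᶜ fun _ : I => A) (∏ᶜ B)
  /-- `Γ` is natural in the family `B`. -/
  natural_right : ∀ (A : C) {B B' : I → C} (b : ∀ i, B i ⟶ B' i) (η : ∀ i, EE A (B i)),
    Γ A B' (fun i => push (b i) (η i)) = push (Limits.Pi.map b) (Γ A B η)
  /-- `Γ` is natural in `A`. -/
  natural_left : ∀ {A A' : C} (a : A' ⟶ A) (B : I → C) (η : ∀ i, EE A (B i)),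
    Γ A' B (fun i => pull a (η i)) = pull (Limits.Pi.map fun _ : I => a) (Γ A B η)
  /-- Products are extriangulated. -/
  realizes : ∀ (A : C) (B : I → C) (η : ∀ i, EE A (B i)) (E : I → C)
    (f : ∀ i, B i ⟶ E i) (g : ∀ i, E i ⟶ A), (∀ i, Realizes (η i) (f i) (g i)) →
      Realizes (Γ A B η) (Limits.Pi.map f) (Limits.Pi.map g)
  /-- Product projections are extriangulated. -/
  projections : ∀ (A : C) (B : I → C) (η : ∀ i, EE A (B i)) (i : I),
    push (Pi.π B i) (Γ A B η) = pull (Pi.π (fun _ : I => A) i) (η i)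

/-- AET4*: the opposite category is AET4. -/
def IsAET4Star : Prop :=
  ∀ (I : Type v) [Nonempty I],
    ∃ _ : HasProductsOfShape I C, Nonempty (ProductTransformation C I)

end AET

/-! ### Negative first extensions and compatibility with (co)products -/

section NegativeExtension

variable (C : Type u) [Category.{v} C] [Preadditive C] [HasZeroObject C]
  [HasBinaryBiproducts C] [ExtriangulatedCategory C]

/-- A negative first extension structure on an extriangulated category
(Adachi--Enomoto--Tsukamoto). -/
structure NegativeFirstExtension where
  /-- The bifunctor `𝔼⁻¹`. -/
  bifunctor : Cᵒᵖ ⥤ C ⥤ AddCommGrpCat.{v}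
  additive_left : bifunctor.Additive
  additive_right : ∀ X : Cᵒᵖ, (bifunctor.obj X).Additive
  /-- `𝔼⁻¹(-, X) ⟶ C(-, A)`, for `δ ∈ 𝔼(X, A)`. -/
  connCov : ∀ {X A : C}, EE X A → (bifunctor.flip.obj X ⟶ preadditiveYoneda.obj A)
  /-- `𝔼⁻¹(A, -) ⟶ C(X, -)`, for `δ ∈ 𝔼(X, A)`. -/
  connContra : ∀ {X A : C}, EE X A →
    (bifunctor.obj (op A) ⟶ preadditiveCoyoneda.obj (op X))
  /-- Exactness of `𝔼⁻¹(W,A) ⟶ 𝔼⁻¹(W,B) ⟶ 𝔼⁻¹(W,X) ⟶ C(W,A) ⟶ C(W,B)`. -/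
  exact_cov : ∀ {A B X : C} (δ : EE X A) (x : A ⟶ B) (y : B ⟶ X), Realizes δ x y →
    ∀ W : C,
      Function.Exact ((bifunctor.obj (op W)).map x) ((bifunctor.obj (op W)).map y) ∧
      Function.Exact ((bifunctor.obj (op W)).map y) ((connCov δ).app (op W)) ∧
      Function.Exact ((connCov δ).app (op W)) (fun h : W ⟶ A => h ≫ x)
  /-- Exactness of `𝔼⁻¹(X,W) ⟶ 𝔼⁻¹(B,W) ⟶ 𝔼⁻¹(A,W) ⟶ C(X,W) ⟶ C(B,W)`. -/
  exact_contra : ∀ {A B X : C} (δ : EE X A) (x : A ⟶ B) (y : B ⟶ X), Realizes δ x y →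
    ∀ W : C,
      Function.Exact ((bifunctor.map y.op).app W) ((bifunctor.map x.op).app W) ∧
      Function.Exact ((bifunctor.map x.op).app W) ((connContra δ).app W) ∧
      Function.Exact ((connContra δ).app W) (fun h : X ⟶ W => y ≫ h)

variable {C}

/-- `C`, with the negative first extension `N`, is coproduct-compatible. -/
def IsCoproductCompatible (N : NegativeFirstExtension C) : Prop :=
  IsAET3 C ∧
    ∀ (X : C) (I : Type v) [Nonempty I] [HasCoproductsOfShape I C] (Y : I → C),
      Function.Surjective
        (fun (χ : (N.bifunctor.obj (op (∐ Y))).obj X) (i : I) =>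
          (((N.bifunctor.map (Sigma.ι Y i).op).app X) χ : (N.bifunctor.obj (op (Y i))).obj X))

/-- `C`, with the negative first extension `N`, is product-compatible. -/
def IsProductCompatible (N : NegativeFirstExtension C) : Prop :=
  IsAET3Star C ∧
    ∀ (X : C) (I : Type v) [Nonempty I] [HasProductsOfShape I C] (Y : I → C),
      Function.Surjective
        (fun (χ : (N.bifunctor.obj (op X)).obj (∏ᶜ Y)) (i : I) =>
          (((N.bifunctor.obj (op X)).map (Pi.π Y i)) χ : (N.bifunctor.obj (op X)).obj (Y i)))

end NegativeExtension

/-! ### Functors and recollements -/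

section Functors

variable {C : Type u₁} [Category.{v} C] [Preadditive C] [HasZeroObject C]
  [HasBinaryBiproducts C] [ExtriangulatedCategory C]
  {D : Type u₂} [Category.{v} D] [Preadditive D] [HasZeroObject D]
  [HasBinaryBiproducts D] [ExtriangulatedCategory D]

/-- The structure of an extriangulated functor on `F`. -/
structure ExtriangulatedFunctor (F : C ⥤ D) where
  additive : F.Additive
  /-- The natural transformation `Γ_F : 𝔼_C ⟶ 𝔼_D ∘ (Fᵒᵖ × F)`. -/
  Γ : ExtensionStructure.bifunctor (C := C) ⟶
    F.op ⋙ ExtensionStructure.bifunctor (C := D) ⋙ (Functor.whiskeringLeft _ _ _).obj F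
  /-- `Γ_F(δ)` is realized by the image under `F` of any realization of `δ`. -/
  realizes : ∀ {A B X : C} (δ : EE X A) (x : A ⟶ B) (y : B ⟶ X), Realizes δ x y →
    Realizes (X := F.obj X) (A := F.obj A) (((Γ.app (op X)).app A) δ) (F.map x) (F.map y)

/-- Right exact functors between extriangulated categories. -/
def IsRightExact (F : C ⥤ D) : Prop :=
  F.Additive ∧ ∀ {C₁ C₀ C₂ : C} (a : C₁ ⟶ C₀) (b : C₀ ⟶ C₂), IsConflation a b →
    ∃ (B₁ B₂ : D) (w : B₁ ⟶ F.obj C₁) (x : F.obj C₁ ⟶ B₂) (y : B₂ ⟶ F.obj C₀),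
      IsConflation w x ∧ IsConflation y (F.map b) ∧ x ≫ y = F.map a

/-- Left exact functors between extriangulated categories. -/
def IsLeftExact (F : C ⥤ D) : Prop :=
  F.Additive ∧ ∀ {C₁ C₀ C₂ : C} (a : C₁ ⟶ C₀) (b : C₀ ⟶ C₂), IsConflation a b →
    ∃ (B₁ B₂ : D) (x : F.obj C₀ ⟶ B₁) (y : B₁ ⟶ F.obj C₂) (w : F.obj C₂ ⟶ B₂),
      IsConflation (F.map a) x ∧ IsConflation y w ∧ x ≫ y = F.map b

/-- The kernel of a functor: the objects that it sends to a zero object. -/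
def functorKer (F : C ⥤ D) : ObjectProperty C := fun X => IsZero (F.obj X)

/-- `P ⋆ Q`: the objects `B` with a conflation `X ⟶ B ⟶ Y`, `X ∈ P` and `Y ∈ Q`. -/
def star (P Q : ObjectProperty C) : ObjectProperty C := fun B =>
  ∃ (X Y : C) (x : X ⟶ B) (y : B ⟶ Y), P X ∧ Q Y ∧ IsConflation x y

/-- `Hom(P, Q) = 0`. -/
def HomZero (P Q : ObjectProperty C) : Prop :=
  ∀ (X Y : C), P X → Q Y → ∀ f : X ⟶ Y, f = 0

end Functors

/-- A recollement `(A, B, C)` of extriangulated categories. The image of a functor is its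
essential image. -/
structure Recollement (A : Type u₁) [Category.{v} A] [Preadditive A] [HasZeroObject A]
    [HasBinaryBiproducts A] [ExtriangulatedCategory A]
    (B : Type u₂) [Category.{v} B] [Preadditive B] [HasZeroObject B]
    [HasBinaryBiproducts B] [ExtriangulatedCategory B]
    (C : Type u₃) [Category.{v} C] [Preadditive C] [HasZeroObject C]
    [HasBinaryBiproducts C] [ExtriangulatedCategory C] where
  /-- `i^*` -/
  iUpperStar : B ⥤ A
  /-- `i_*` -/
  iLowerStar : A ⥤ B
  /-- `i^!` -/
  iUpperShriek : B ⥤ A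
  /-- `j_!` -/
  jLowerShriek : C ⥤ B
  /-- `j^*` -/
  jUpperStar : B ⥤ C
  /-- `j_*` -/
  jLowerStar : C ⥤ B
  /-- (AR1) -/
  adjI₁ : iUpperStar ⊣ iLowerStar
  adjI₂ : iLowerStar ⊣ iUpperShriek
  adjJ₁ : jLowerShriek ⊣ jUpperStar
  adjJ₂ : jUpperStar ⊣ jLowerStar
  /-- (AR2) -/
  full_i : iLowerStar.Full
  faithful_i : iLowerStar.Faithful
  full_jShriek : jLowerShriek.Full
  faithful_jShriek : jLowerShriek.Faithful
  full_jStar : jLowerStar.Full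
  faithful_jStar : jLowerStar.Faithful
  /-- (AR3) -/
  im_eq_ker : iLowerStar.essImage = functorKer jUpperStar
  /-- (ER4) -/
  rightExact_i : IsRightExact iUpperStar
  rightExact_j : IsRightExact jLowerShriek
  /-- (ER5) -/
  leftExact_i : IsLeftExact iUpperShriek
  leftExact_j : IsLeftExact jLowerStar
  /-- (ER6) -/
  extriangulated_i : ExtriangulatedFunctor iLowerStar
  extriangulated_j : ExtriangulatedFunctor jUpperStar
  /-- (ER7) `(Ker i^*, Im i_*, Ker i^!)` is a TTF triple. -/
  hom_im_ker : HomZero iLowerStar.essImage (functorKer iUpperShriek)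
  hom_ker_im : HomZero (functorKer iUpperStar) iLowerStar.essImage
  ker_star_im : ∀ X : B, star (functorKer iUpperStar) iLowerStar.essImage X
  im_star_ker : ∀ X : B, star iLowerStar.essImage (functorKer iUpperShriek) X

end Extriang

open Extriang

namespace Extriang

/-! ### Naturality of the comparison maps for coproducts and products. -/

section Comparison

variable {C : Type u₁} [Category.{v} C] {D : Type u₂} [Category.{v} D] {I : Type v}

/-! Everything reduces to the claim that $i_*$ induces bijections on extension groups. Injectivity
(`mapExt_injective`): if the image of $\delta$ splits, full faithfulness lifts the splitting.
Surjectivity (`Recollement.mapExt_surjective`): since $\operatorname{Im} i_* = \operatorname{Ker}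
j^*$ is closed under extensions, the middle term of a conflation between objects of
$\operatorname{Im} i_*$ lies there too; right exactness of $i^*$ then gives a conflation in
$\mathcal{A}$ whose image under $i_*$ maps to the given one, and the given extension is recovered by
pushing and pulling. This is (c). For (a) and (b), $i_*$ has adjoints on both sides, so it preserves
coproducts and products, and the transformation $\Gamma$ of $\mathcal{B}$ is transported to
$\mathcal{A}$ through these bijections (`coproductTransformation`, `productTransformation`).
Realizations come back to $\mathcal{A}$ by `realizes_of_map` and `Realizes.of_iso`. -/

lemma sigmaMap_comparison (F : C ⥤ D) [HasCoproductsOfShape I C]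
    [HasCoproductsOfShape I D] {B B' : I → C} (c : ∀ i, B' i ⟶ B i) :
    Limits.Sigma.map (fun i => F.map (c i)) ≫ sigmaComparison F B =
      sigmaComparison F B' ≫ F.map (Limits.Sigma.map c) := by
  refine Limits.Sigma.hom_ext _ _ fun i => ?_
  rw [Sigma.ι_map_assoc, ι_comp_sigmaComparison, ι_comp_sigmaComparison_assoc, ← F.map_comp,
    ← F.map_comp, Sigma.ι_map]

lemma piComparison_map (F : C ⥤ D) [HasProductsOfShape I C]
    [HasProductsOfShape I D] {B B' : I → C} (b : ∀ i, B i ⟶ B' i) :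
    piComparison F B ≫ Limits.Pi.map (fun i => F.map (b i)) =
      F.map (Limits.Pi.map b) ≫ piComparison F B' := by
  refine Limits.Pi.hom_ext _ _ fun i => ?_
  rw [Category.assoc, Category.assoc, Pi.map_π, piComparison_comp_π, piComparison_comp_π_assoc,
    ← F.map_comp, ← F.map_comp, Pi.map_π]

end Comparison

/-! ### Calculus of pushing and pulling extensions. -/

section Basic

variable {C : Type u} [Category.{v} C] [Preadditive C] [ExtensionStructure C]

@[simp]
lemma push_id {X A : C} (δ : EE X A) : push (𝟙 A) δ = δ := by
  simp [push]

@[simp]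
lemma pull_id {X A : C} (δ : EE X A) : pull (𝟙 X) δ = δ := by
  simp [pull]

lemma push_comp {X A A' A'' : C} (a : A ⟶ A') (a' : A' ⟶ A'') (δ : EE X A) :
    push (a ≫ a') δ = push a' (push a δ) := by
  simp [push]

lemma pull_comp {X X' X'' A : C} (c : X' ⟶ X) (c' : X'' ⟶ X') (δ : EE X A) :
    pull (c' ≫ c) δ = pull c' (pull c δ) := by
  simp [pull]

lemma push_pull {X X' A A' : C} (a : A ⟶ A') (c : X' ⟶ X) (δ : EE X A) :
    push a (pull c δ) = pull c (push a δ) :=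
  (ConcreteCategory.congr_hom
    (((ExtensionStructure.bifunctor (C := C)).map c.op).naturality a) δ).symm

lemma push_injective {X A A' : C} (a : A ⟶ A') [IsIso a] :
    Function.Injective (push (X := X) a) := fun δ δ' h => by
  simpa [← push_comp] using congrArg (push (inv a)) h

lemma pull_injective {X X' A : C} (c : X' ⟶ X) [IsIso c] :
    Function.Injective (pull (A := A) c) := fun δ δ' h => by
  simpa [← pull_comp] using congrArg (pull (inv c)) h

end Basic

/-! ### Consequences of the axioms for realizations. -/

section Realizations

variable {C : Type u} [Category.{v} C] [Preadditive C] [HasZeroObject C]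
  [HasBinaryBiproducts C] [ExtriangulatedCategory C]

open ZeroObject

/-- Trivial conflations such as this one and `realizes_id_zero` serve as targets for ET3, which
replaces the long exact sequences below. -/
lemma realizes_zero_id (X : C) :
    Realizes (0 : EE X (0 : C)) (0 : (0 : C) ⟶ X) (𝟙 X) := by
  refine (ExtriangulatedCategory.realizes_iff _ _ _ _ _
    (ExtriangulatedCategory.realizes_zero X 0)).2
    ⟨⟨biprod.snd, biprod.inr, ?_, by simp⟩, by simp, by simp⟩
  ext; simp

lemma realizes_id_zero (A : C) :
    Realizes (0 : EE (0 : C) A) (𝟙 A) (0 : A ⟶ (0 : C)) := by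
  refine (ExtriangulatedCategory.realizes_iff _ _ _ _ _
    (ExtriangulatedCategory.realizes_zero 0 A)).2
    ⟨⟨biprod.fst, biprod.inl, ?_, by simp⟩, by simp, (isZero_zero C).eq_of_tgt _ _⟩
  ext; simp

/-- The inflation of a realization of `δ` kills `δ`. -/
lemma push_inflation {A B X : C} {δ : EE X A} {x : A ⟶ B} {y : B ⟶ X} (h : Realizes δ x y) :
    push x δ = 0 := by
  -- ET3 for the square $(x, 1_B)$ into $B = B \to 0$ identifies $x\cdot\delta$ with a pullback of
  -- zero.
  obtain ⟨c, hc, -⟩ := ExtriangulatedCategory.et3 δ 0 x y _ _ h (realizes_id_zero B) x (𝟙 B) rfl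
  simpa using hc

/-- A morphism that vanishes on the inflation factors through the deflation. -/
lemma exists_factor_deflation {A B X W : C} {δ : EE X A} {x : A ⟶ B} {y : B ⟶ X}
    (h : Realizes δ x y) (u : B ⟶ W) (hu : x ≫ u = 0) : ∃ s : X ⟶ W, y ≫ s = u := by
  obtain ⟨s, -, hs⟩ := ExtriangulatedCategory.et3 δ 0 x y _ _ h (realizes_zero_id W) 0 u
    (by simp [hu])
  exact ⟨s, by simpa using hs⟩

/-- An endomorphism of a conflation that is the identity on both ends is an isomorphism. -/
lemma isIso_of_comp_eq {A B X : C} {δ : EE X A} {x : A ⟶ B} {y : B ⟶ X}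
    (h : Realizes δ x y) (b : B ⟶ B) (hx : x ≫ b = x) (hy : b ≫ y = y) : IsIso b := by
  -- The difference $b - 1$ factors as $ys$ because it vanishes on $x$, and it squares to zero
  -- because it is killed by $y$. Hence $b = 1 + ys$ has inverse $1 - ys$.
  obtain ⟨s, hs⟩ := exists_factor_deflation h (b - 𝟙 B) (by simp [hx])
  have hb : b = 𝟙 B + y ≫ s := by simp [hs]
  have hyy : y ≫ s ≫ y = 0 := by rw [← Category.assoc, hs]; simp [hy]
  have hsq : y ≫ s ≫ y ≫ s = 0 := by
    rw [← Category.assoc s, ← Category.assoc, hyy, zero_comp]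
  refine ⟨𝟙 B - y ≫ s, ?_, ?_⟩ <;> rw [hb] <;> simp [hsq]

/-- If `δ` is realized by `A ⟶ B ⟶ X`, then any isomorphic sequence realizes the corresponding
extension. -/
lemma Realizes.of_iso {A B X A' B' X' : C} {δ : EE X A} {x : A ⟶ B} {y : B ⟶ X}
    (h : Realizes δ x y) {δ' : EE X' A'} {x' : A' ⟶ B'} {y' : B' ⟶ X'}
    (a : A ⟶ A') (b : B ⟶ B') (c : X ⟶ X') [IsIso a] [IsIso b] [IsIso c]
    (hx : x ≫ b = a ≫ x') (hy : y ≫ c = b ≫ y') (hδ : push a δ = pull c δ') :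
    Realizes δ' x' y' := by
  obtain ⟨E, p, q, hE⟩ := ExtriangulatedCategory.exists_realization δ'
  obtain ⟨f, hf₁, hf₂⟩ := ExtriangulatedCategory.realize_hom δ δ' x y p q h hE a c hδ
  have hδ' : push (inv a) δ' = pull (inv c) δ := by
    apply push_injective a
    apply pull_injective c
    rw [push_pull, ← push_comp, ← pull_comp]
    simp [hδ]
  obtain ⟨g, hg₁, hg₂⟩ := ExtriangulatedCategory.realize_hom δ' δ p q x y hE h (inv a) (inv c) hδ'
  -- The lifts `f` and `g` need not be mutually inverse, but both composites are the identity on the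
  -- outer terms, hence invertible.
  have h₁ : IsIso (f ≫ g) := isIso_of_comp_eq h _
    (by rw [← Category.assoc, hf₁, Category.assoc, hg₁, IsIso.hom_inv_id_assoc])
    (by rw [Category.assoc, ← hg₂, ← Category.assoc, ← hf₂, Category.assoc, IsIso.hom_inv_id,
      Category.comp_id])
  have h₂ : IsIso (g ≫ f) := isIso_of_comp_eq hE _
    (by rw [← Category.assoc, hg₁, Category.assoc, hf₁, IsIso.inv_hom_id_assoc])
    (by rw [Category.assoc, ← hf₂, ← Category.assoc, ← hg₂, Category.assoc, IsIso.inv_hom_id,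
      Category.comp_id])
  have hg : IsIso g := by
    have : IsSplitMono g := ⟨⟨⟨f ≫ inv (g ≫ f), by simp [← Category.assoc]⟩⟩⟩
    have : IsSplitEpi g := ⟨⟨⟨inv (f ≫ g) ≫ f, by simp⟩⟩⟩
    exact isIso_of_mono_of_isSplitEpi g
  refine (ExtriangulatedCategory.realizes_iff δ' p q x' y' hE).2 ⟨asIso (g ≫ b), ?_, ?_⟩
  · rw [asIso_hom, ← Category.assoc, hg₁, Category.assoc, hx, IsIso.inv_hom_id_assoc]
  · rw [asIso_hom, Category.assoc, ← hy, ← Category.assoc, ← hg₂, Category.assoc,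
      IsIso.inv_hom_id, Category.comp_id]

end Realizations

/-! ### Fully faithful extriangulated functors and transport of AET4 and AET4*. -/

section Functors

variable {C : Type u₁} [Category.{v} C] [Preadditive C] [HasZeroObject C]
  [HasBinaryBiproducts C] [ExtriangulatedCategory C]
  {D : Type u₂} [Category.{v} D] [Preadditive D] [HasZeroObject D]
  [HasBinaryBiproducts D] [ExtriangulatedCategory D]

namespace ExtriangulatedFunctor

variable {F : C ⥤ D} (h : ExtriangulatedFunctor F)

/-- The homomorphism `𝔼(X, A) ⟶ 𝔼(FX, FA)` of an extriangulated functor. -/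
def mapExt (X A : C) : EE X A →+ EE (F.obj X) (F.obj A) :=
  ((h.Γ.app (op X)).app A).hom

lemma realizes_mapExt {A B X : C} {δ : EE X A} {x : A ⟶ B} {y : B ⟶ X} (hδ : Realizes δ x y) :
    Realizes (h.mapExt X A δ) (F.map x) (F.map y) :=
  h.realizes δ x y hδ

lemma mapExt_push {X A A' : C} (a : A ⟶ A') (δ : EE X A) :
    h.mapExt X A' (push a δ) = push (F.map a) (h.mapExt X A δ) :=
  ConcreteCategory.congr_hom ((h.Γ.app (op X)).naturality a) δ

lemma mapExt_pull {X X' A : C} (c : X' ⟶ X) (δ : EE X A) :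
    h.mapExt X' A (pull c δ) = pull (F.map c) (h.mapExt X A δ) :=
  ConcreteCategory.congr_hom (NatTrans.congr_app (h.Γ.naturality c.op) A) δ

lemma isIso_Γ (hbij : ∀ X A, Function.Bijective (h.mapExt X A)) : IsIso h.Γ := by
  have (X : Cᵒᵖ) : IsIso (h.Γ.app X) := by
    have (A : C) : IsIso ((h.Γ.app X).app A) :=
      (ConcreteCategory.isIso_iff_bijective _).2 (hbij X.unop A)
    exact NatIso.isIso_of_isIso_app _
  exact NatIso.isIso_of_isIso_app _

variable [F.Full] [F.Faithful]

/-- If the image extension is zero, $Fx$ has a retraction; fullness and faithfulness lift it to a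
retraction $r$ of $x$, so $\delta = r\cdot(x\cdot\delta) = 0$. -/
lemma mapExt_injective (X A : C) : Function.Injective (h.mapExt X A) := by
  refine (injective_iff_map_eq_zero _).2 fun δ hδ => ?_
  obtain ⟨B, x, y, hxy⟩ := ExtriangulatedCategory.exists_realization δ
  have hF := h.realizes_mapExt hxy
  rw [hδ] at hF
  obtain ⟨e, he, -⟩ := (ExtriangulatedCategory.realizes_iff _ _ _ _ _ hF).1
    (ExtriangulatedCategory.realizes_zero _ _)
  have hr : x ≫ F.preimage (e.hom ≫ biprod.fst) = 𝟙 A := F.map_injective (by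
    rw [F.map_comp, F.map_preimage, ← Category.assoc, he]; simp)
  rw [← push_id δ, ← hr, push_comp, push_inflation hxy, map_zero]

/-- A fully faithful extriangulated functor reflects realizations. -/
lemma realizes_of_map {A B X : C} {δ : EE X A} {x : A ⟶ B} {y : B ⟶ X}
    (hF : Realizes (h.mapExt X A δ) (F.map x) (F.map y)) : Realizes δ x y := by
  obtain ⟨E, p, q, hE⟩ := ExtriangulatedCategory.exists_realization δ
  obtain ⟨e, he₁, he₂⟩ := (ExtriangulatedCategory.realizes_iff _ _ _ _ _
    (h.realizes_mapExt hE)).1 hF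
  refine (ExtriangulatedCategory.realizes_iff _ _ _ _ _ hE).2 ⟨F.preimageIso e, ?_, ?_⟩ <;>
    apply F.map_injective <;> simp [he₁, he₂]

section Coproducts

variable (hbij : ∀ X A, Function.Bijective (h.mapExt X A))
  {I : Type v} [HasCoproductsOfShape I C] [HasCoproductsOfShape I D]
  [PreservesColimitsOfShape (Discrete I) F]

/-- The isomorphism `𝔼(∐ Bᵢ, A) ≅ 𝔼(∐ FBᵢ, FA)` for a functor that preserves coproducts and
induces isomorphisms on extensions. -/
noncomputable def sigmaExtEquiv (B : I → C) (A : C) :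
    EE (∐ B) A ≃+ EE (∐ fun i => F.obj (B i)) (F.obj A) :=
  AddEquiv.ofBijective ((pull (sigmaComparison F B)).comp (h.mapExt (∐ B) A))
    ⟨(pull_injective _).comp (h.mapExt_injective _ _), fun ε => by
      obtain ⟨δ, hδ⟩ := (hbij _ _).2 (pull (inv (sigmaComparison F B)) ε)
      exact ⟨δ, by simp [hδ, ← pull_comp]⟩⟩

lemma sigmaExtEquiv_apply (B : I → C) (A : C) (δ : EE (∐ B) A) :
    h.sigmaExtEquiv hbij B A δ = pull (sigmaComparison F B) (h.mapExt (∐ B) A δ) := rfl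

/-- The data of AET4 restricts along a fully faithful extriangulated functor that preserves
coproducts and induces isomorphisms on extensions. -/
noncomputable def coproductTransformation (T : CoproductTransformation D I) :
    CoproductTransformation C I := by
  let G (B : I → C) (A : C) : (∀ i, EE (B i) A) →+ EE (∐ B) (∐ fun _ : I => A) :=
    (h.sigmaExtEquiv hbij B _).symm.toAddMonoidHom.comp
      ((push (sigmaComparison F fun _ : I => A)).comp
        ((T.Γ (fun i => F.obj (B i)) (F.obj A)).comp
          (AddMonoidHom.pi fun i => (h.mapExt (B i) A).comp (Pi.evalAddMonoidHom _ i))))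
  -- This equation characterizes `G`. Each axiom is checked in `D`, after applying the injective map
  -- on extensions and, where needed, pulling back along the comparison isomorphism.
  have hG (B : I → C) (A : C) (η : ∀ i, EE (B i) A) :
      pull (sigmaComparison F B) (h.mapExt _ _ (G B A η)) =
        push (sigmaComparison F fun _ : I => A)
          (T.Γ (fun i => F.obj (B i)) (F.obj A) fun i => h.mapExt (B i) A (η i)) :=
    (h.sigmaExtEquiv hbij B _).apply_symm_apply _
  refine ⟨G, ?_, ?_, ?_, ?_⟩
  · intro B B' c A η
    apply h.mapExt_injective
    apply pull_injective (sigmaComparison F B')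
    rw [hG, mapExt_pull, ← pull_comp, ← sigmaMap_comparison, pull_comp, hG, ← push_pull,
      ← T.natural_left]
    simp only [mapExt_pull]
  · intro B A A' a η
    apply h.mapExt_injective
    apply pull_injective (sigmaComparison F B)
    rw [hG, mapExt_push, ← push_pull, hG, ← push_comp, ← sigmaMap_comparison, push_comp,
      ← T.natural_right]
    simp only [mapExt_push]
  · intro B A η E f g hfg
    apply h.realizes_of_map
    exact (T.realizes _ _ _ _ _ _ fun i => h.realizes_mapExt (hfg i)).of_iso
      (sigmaComparison F fun _ : I => A) (sigmaComparison F E) (sigmaComparison F B)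
      (sigmaMap_comparison F (B' := fun _ : I => A) f) (sigmaMap_comparison F g) (hG B A η).symm
  · intro B A η i
    apply h.mapExt_injective
    rw [mapExt_pull, mapExt_push, ← ι_comp_sigmaComparison, pull_comp, hG, ← push_pull,
      T.inclusions, ← push_comp, ι_comp_sigmaComparison F (fun _ : I => A) i]

end Coproducts

section Products

variable (hbij : ∀ X A, Function.Bijective (h.mapExt X A))
  {I : Type v} [HasProductsOfShape I C] [HasProductsOfShape I D]
  [PreservesLimitsOfShape (Discrete I) F]

/-- The isomorphism `𝔼(A, ∏ Bᵢ) ≅ 𝔼(FA, ∏ FBᵢ)` for a functor that preserves products and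
induces isomorphisms on extensions. -/
noncomputable def piExtEquiv (A : C) (B : I → C) :
    EE A (∏ᶜ B) ≃+ EE (F.obj A) (∏ᶜ fun i => F.obj (B i)) :=
  AddEquiv.ofBijective ((push (piComparison F B)).comp (h.mapExt A (∏ᶜ B)))
    ⟨(push_injective _).comp (h.mapExt_injective _ _), fun ε => by
      obtain ⟨δ, hδ⟩ := (hbij _ _).2 (push (inv (piComparison F B)) ε)
      exact ⟨δ, by simp [hδ, ← push_comp]⟩⟩

/-- The data of AET4* restricts along a fully faithful extriangulated functor that preserves
products and induces isomorphisms on extensions. -/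
noncomputable def productTransformation (T : ProductTransformation D I) :
    ProductTransformation C I := by
  let G (A : C) (B : I → C) : (∀ i, EE A (B i)) →+ EE (∏ᶜ fun _ : I => A) (∏ᶜ B) :=
    (h.piExtEquiv hbij _ B).symm.toAddMonoidHom.comp
      ((pull (piComparison F fun _ : I => A)).comp
        ((T.Γ (F.obj A) (fun i => F.obj (B i))).comp
          (AddMonoidHom.pi fun i => (h.mapExt A (B i)).comp (Pi.evalAddMonoidHom _ i))))
  have hG (A : C) (B : I → C) (η : ∀ i, EE A (B i)) :
      push (piComparison F B) (h.mapExt _ _ (G A B η)) =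
        pull (piComparison F fun _ : I => A)
          (T.Γ (F.obj A) (fun i => F.obj (B i)) fun i => h.mapExt A (B i) (η i)) :=
    (h.piExtEquiv hbij _ B).apply_symm_apply _
  refine ⟨G, ?_, ?_, ?_, ?_⟩
  · intro A B B' b η
    apply h.mapExt_injective
    apply push_injective (piComparison F B')
    rw [hG, mapExt_push, ← push_comp, ← piComparison_map, push_comp, hG, push_pull,
      ← T.natural_right]
    simp only [mapExt_push]
  · intro A A' a B η
    apply h.mapExt_injective
    apply push_injective (piComparison F B)
    rw [hG, mapExt_pull, push_pull, hG, ← pull_comp, ← piComparison_map, pull_comp,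
      ← T.natural_left]
    simp only [mapExt_pull]
  · intro A B η E f g hfg
    apply h.realizes_of_map
    -- Product comparisons point from $F(\prod)$ to $\prod F$, so their inverses carry the
    -- realization given by `T` to the image sequence.
    refine (T.realizes _ _ _ _ _ _ fun i => h.realizes_mapExt (hfg i)).of_iso
      (inv (piComparison F B)) (inv (piComparison F E)) (inv (piComparison F fun _ : I => A))
      ?_ ?_ ?_
    · rw [IsIso.comp_inv_eq, Category.assoc, ← piComparison_map, IsIso.inv_hom_id_assoc]
    · rw [IsIso.comp_inv_eq, Category.assoc, ← piComparison_map F (B' := fun _ : I => A),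
        IsIso.inv_hom_id_assoc]
    · apply push_injective (piComparison F B)
      rw [push_pull, hG, ← push_comp, ← pull_comp]
      simp
  · intro A B η i
    apply h.mapExt_injective
    rw [mapExt_pull, mapExt_push, ← piComparison_comp_π, push_comp, hG, push_pull,
      T.projections, ← pull_comp, piComparison_comp_π F (fun _ : I => A) i]

end Products

end ExtriangulatedFunctor

/-- The kernel of an extriangulated functor is closed under extensions. -/
lemma ExtriangulatedFunctor.isZero_of_isConflation {F : C ⥤ D} (h : ExtriangulatedFunctor F)
    {A B X : C} {x : A ⟶ B} {y : B ⟶ X} (hxy : IsConflation x y)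
    (hA : IsZero (F.obj A)) (hX : IsZero (F.obj X)) : IsZero (F.obj B) := by
  obtain ⟨δ, hδ⟩ := hxy
  -- With $FA = 0$ the identity of $FB$ factors through $FX = 0$.
  obtain ⟨s, hs⟩ := exists_factor_deflation (h.realizes_mapExt hδ) (𝟙 (F.obj B))
    (hA.eq_of_src _ _)
  rw [IsZero.iff_id_eq_zero, ← hs, hX.eq_of_src s 0, comp_zero]

end Functors

/-! ### The functor $i_*$ of a recollement. -/

section Recollements

variable {A : Type u₁} [Category.{v} A] [Preadditive A] [HasZeroObject A]
  [HasBinaryBiproducts A] [ExtriangulatedCategory A]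
  {B : Type u₂} [Category.{v} B] [Preadditive B] [HasZeroObject B]
  [HasBinaryBiproducts B] [ExtriangulatedCategory B]
  {C : Type u₃} [Category.{v} C] [Preadditive C] [HasZeroObject C]
  [HasBinaryBiproducts C] [ExtriangulatedCategory C]

lemma Recollement.mapExt_surjective (R : Recollement A B C) (X Y : A) :
    Function.Surjective (R.extriangulated_i.mapExt X Y) := by
  intro ε
  have := R.full_i
  have := R.faithful_i
  obtain ⟨E, x, y, hε⟩ := ExtriangulatedCategory.exists_realization ε
  have hker (Z : A) : IsZero (R.jUpperStar.obj (R.iLowerStar.obj Z)) :=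
    R.im_eq_ker.le _ (R.iLowerStar.obj_mem_essImage Z)
  -- Since $j^*$ is extriangulated, its kernel is closed under extensions; so `E` lies in
  -- $\operatorname{Im} i_*$ and the unit at `E` is invertible.
  have hE : R.iLowerStar.essImage E := R.im_eq_ker.ge _
    (R.extriangulated_j.isZero_of_isConflation ⟨ε, hε⟩ (hker Y) (hker X))
  have : IsIso (R.adjI₁.unit.app E) := R.adjI₁.isIso_unit_app_of_iso hE.getIso.symm
  -- Only the second conflation of right exactness matters: $K \to i^*E \to i^*i_*X$, realizing `δ`
  -- in $\mathcal{A}$.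
  obtain ⟨-, K, -, -, k, -, ⟨δ, hδ⟩, -⟩ := R.rightExact_i.2 x y ⟨ε, hε⟩
  -- The inverse unit and the counit map the deflation of the $i_*$-image onto `y`. The induced `a`
  -- on the left satisfies $a\cdot i_*\delta = \varepsilon\cdot i_*(\text{counit})$; as the counit
  -- is invertible, this determines `ε` without `a` having to be an isomorphism.
  obtain ⟨a, ha, -⟩ := ExtriangulatedCategory.et3_op _ ε _ _ x y
    (R.extriangulated_i.realizes_mapExt hδ) hε (inv (R.adjI₁.unit.app E))
    (R.iLowerStar.map (R.adjI₁.counit.app X)) (by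
      rw [← cancel_epi (R.adjI₁.unit.app E)]
      simp)
  refine ⟨push (R.iLowerStar.preimage a) (pull (inv (R.adjI₁.counit.app X)) δ), ?_⟩
  rw [R.extriangulated_i.mapExt_push, R.extriangulated_i.mapExt_pull, Functor.map_preimage,
    push_pull]
  refine (congrArg _ ha).trans ?_
  rw [← pull_comp, ← Functor.map_comp]
  simp

lemma Recollement.mapExt_bijective (R : Recollement A B C) (X Y : A) :
    Function.Bijective (R.extriangulated_i.mapExt X Y) :=
  have := R.full_i
  have := R.faithful_i
  ⟨R.extriangulated_i.mapExt_injective X Y, R.mapExt_surjective X Y⟩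

lemma Recollement.isAET4 (R : Recollement A B C) (hA : IsAET3 A) (hB : IsAET4 B) : IsAET4 A := by
  intro I _
  have := R.full_i
  have := R.faithful_i
  -- Coproducts are preserved because $i_*$ is left adjoint to $i^!$.
  have := R.adjI₂.leftAdjoint_preservesColimits
  have := hA I
  obtain ⟨_, ⟨T⟩⟩ := hB I
  exact ⟨inferInstance, ⟨R.extriangulated_i.coproductTransformation R.mapExt_bijective T⟩⟩

lemma Recollement.isAET4Star (R : Recollement A B C) (hA : IsAET3Star A) (hB : IsAET4Star B) :
    IsAET4Star A := by
  intro I _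
  have := R.full_i
  have := R.faithful_i
  -- Products are preserved because $i_*$ is right adjoint to $i^*$.
  have := R.adjI₁.rightAdjoint_preservesLimits
  have := hA I
  obtain ⟨_, ⟨T⟩⟩ := hB I
  exact ⟨inferInstance, ⟨R.extriangulated_i.productTransformation R.mapExt_bijective T⟩⟩

end Recollements

end Extriang

theorem mainTheorem4
    {A : Type u₁} [Category.{v} A] [Preadditive A] [HasZeroObject A]
    [HasBinaryBiproducts A] [ExtriangulatedCategory A]
    {B : Type u₂} [Category.{v} B] [Preadditive B] [HasZeroObject B]
    [HasBinaryBiproducts B] [ExtriangulatedCategory B]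
    {C : Type u₃} [Category.{v} C] [Preadditive C] [HasZeroObject C]
    [HasBinaryBiproducts C] [ExtriangulatedCategory C]
    (R : Recollement A B C) :
    (∀ N : NegativeFirstExtension A, IsCoproductCompatible N → IsAET4 B → IsAET4 A) ∧
    (∀ N : NegativeFirstExtension A, IsProductCompatible N → IsAET4Star B → IsAET4Star A) ∧
    ((IsAET4 B ∨ IsAET4Star B) → IsIso R.extriangulated_i.Γ) :=
  ⟨fun _ hN hB => R.isAET4 hN.1 hB, fun _ hN hB => R.isAET4Star hN.1 hB,
    fun _ => R.extriangulated_i.isIso_Γ R.mapExt_bijective⟩
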